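/- **Problem.** An instance of *eventual influence limitation* (EIL) consists of a loopless directed graph $G=(V,E)$ with $|V|=n$, $|E|=m$, an adversary node $v_c\in V$, and probabilities $p_C(e)\in[0,1]$ for $e\in E$. Each edge is independently *realized* with probability $p_C(e)$; let $g$ be the random set of realized edges. For a seed set $S\subseteq V\setminus\{v_c\}$, campaign $C$ starts active at $v_c$ and campaign $L$ at the nodes of $S$, all other nodes being inactive. In each time step, every inactive node with an in-neighbour (in $G$) active in $L$ becomes active in $L$, and every other inactive node with an in-neighbour along an edge of $g$ active in $C$ becomes active in $C$; active nodes never change. The prevention $\pi(S)$ is the number of nodes that eventually adopt $C$ if $L$ is absent, but do not adopt $C$ if $L$ starts from $S$. For $k\ge 1$, a set $S\subseteq V\setminus\{v_c\}$ with $|S|\le k$ is *$\beta$-approximate* if $\mathbb E[\pi(S)]\ge\beta\,\mathbb E[\pi(S')]$ for all $S'\subseteq V\setminus\{v_c\}$ with $|S'|=k$. **Model.** A randomized algorithm is given $v_c$ (and may depend on $n,m,k,\beta$ and on the required success probability). One unit of time pays for one of the following operations: drawing a uniformly random node; asking for the out-degree or in-degree of a node; reading one entry (a neighbour, with the probability $p_C$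 of the edge) of the out- or in-adjacency list of a node; writing one node into the output. Internal computation and internal discrete random choices are free. The running time is the number of these operations before halting. **Theorem.** Let $k\ge1$ be an integer and $0<\beta\le 1$. 1. For all $0<\epsilon<\frac1{10e}$, all $n>k$, and $m=n-1$: every randomized algorithm that on each EIL instance with $n$ nodes and $m$ edges returns a $\beta$-approximate seed set with probability at least $1-\frac1e-\epsilon$ has, on at least one such instance, expected running time at least $$\frac{\beta\,(m+n)}{24\,\min\{k,1/\beta\}} .$$ 2. There are $c>0$ and $n_0$, depending only on $k$ and $\beta$, such that the same holds for all $0<\epsilon<\frac1{10e}$, all $n\ge n_0$ and every $m$ with $n-1\le m\le c\,n^2$. -/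

import Mathlib

open scoped ENNReal

noncomputable section

namespace EIL

/-- An instance of eventual influence limitation on `n` nodes, with the high effectiveness property:
a directed graph without loops, the adversary node `vc` (`A_C = {vc}`), and for each edge `e` the
probability `pC e` that campaign `C` propagates along `e`. Campaign `L` propagates along every edge
with probability one. The orders in which the out- and in-adjacency lists enumerate the neighbours
are arbitrary and belong to the representation of the instance. -/
structure Network (n : ℕ) where
  vc : Fin n
  edges : Finset (Fin n × Fin n)
  loopless : ∀ v, (v, v) ∉ edges
  pC : Fin n × Fin n → ℝ
  pC_mem : ∀ e, pC e ∈ Set.Icc (0 : ℝ) 1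
  outList : Fin n → List (Fin n)
  outList_nodup : ∀ u, (outList u).Nodup
  mem_outList : ∀ u v, v ∈ outList u ↔ (u, v) ∈ edges
  inList : Fin n → List (Fin n)
  inList_nodup : ∀ v, (inList v).Nodup
  mem_inList : ∀ u v, u ∈ inList v ↔ (u, v) ∈ edges

/-- The pair (nodes active in campaign `C`, nodes active in campaign `L`). -/
abbrev Status (n : ℕ) := Finset (Fin n) × Finset (Fin n)

/-- The nodes that campaign `L` activates next: inactive nodes with an in-neighbour active in `L`. -/
def newL {n : ℕ} (E : Finset (Fin n × Fin n)) (a : Status n) : Finset (Fin n) :=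
  {v | v ∉ a.1 ∧ v ∉ a.2 ∧ ∃ u ∈ a.2, (u, v) ∈ E}

/-- The nodes that campaign `C` activates next along the realized edges `g`: inactive nodes with an
in-neighbour active in `C`, unless campaign `L` activates them at the same time. -/
def newC {n : ℕ} (E g : Finset (Fin n × Fin n)) (a : Status n) : Finset (Fin n) :=
  {v | v ∉ a.1 ∧ v ∉ a.2 ∧ v ∉ newL E a ∧ ∃ u ∈ a.1, (u, v) ∈ g}

/-- One time step of the two-campaign cascade when `g` is the set of edges realized for `C`.
(The attempt of a node along an edge succeeds or fails once and for all, namely when the node has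
just been activated, so letting all active nodes act in every step changes nothing.) -/
def cascadeStep {n : ℕ} (E g : Finset (Fin n × Fin n)) (a : Status n) : Status n :=
  (a.1 ∪ newC E g a, a.2 ∪ newL E a)

namespace Network

variable {n : ℕ}

/-- The number `m` of edges. -/
def numEdges (I : Network n) : ℕ := I.edges.card

/-- The nodes that have adopted campaign `C` when the cascade from `A_C = {vc}` and `A_L = S` has
converged (each step before convergence activates a node, so `n` steps suffice). -/
def adoptC (I : Network n) (g : Finset (Fin n × Fin n)) (S : Finset (Fin n)) : Finset (Fin n) :=
  ((cascadeStep I.edges g)^[n] ({I.vc}, S)).1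

/-- The prevention `π(S)` on the realization `g`: the number of nodes that adopt `C` in the absence
of campaign `L`, but not when `L` starts from `S`. -/
def prevention (I : Network n) (g : Finset (Fin n × Fin n)) (S : Finset (Fin n)) : ℕ :=
  (I.adoptC g ∅ \ I.adoptC g S).card

/-- The probability that `g` is the set of realized edges, each edge being realized independently. -/
def realizationProb (I : Network n) (g : Finset (Fin n × Fin n)) : ℝ :=
  (∏ e ∈ g, I.pC e) * ∏ e ∈ I.edges \ g, (1 - I.pC e)

/-- The expected prevention `𝔼[π(S)]`. -/
def expectedPrevention (I : Network n) (S : Finset (Fin n)) : ℝ :=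
  ∑ g ∈ I.edges.powerset, I.realizationProb g * (I.prevention g S : ℝ)

/-- `S` is a seed set for `L` of at most `k` nodes, none of them the adversary node, and its
expected prevention is at least `β` times that of every seed set of size `k`. -/
def IsApprox (I : Network n) (k : ℕ) (β : ℝ) (S : Finset (Fin n)) : Prop :=
  I.vc ∉ S ∧ S.card ≤ k ∧
    ∀ S' : Finset (Fin n), I.vc ∉ S' → S'.card = k →
      β * I.expectedPrevention S' ≤ I.expectedPrevention S

end Network

/-- The basic operations, each of which costs one unit of time: drawing a uniformly random node,
asking for the out- or in-degree of a node or for an entry of its out- or in-adjacency list, and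
writing a node into the output. `halt` ends the computation. -/
inductive Op (n : ℕ) where
  | halt
  | sample
  | outDegree (v : Fin n)
  | inDegree (v : Fin n)
  | outEntry (v : Fin n) (i : ℕ)
  | inEntry (v : Fin n) (i : ℕ)
  | write (v : Fin n)

/-- The answers to the basic operations. An entry of an adjacency list consists of the neighbour
and of the propagation probability of the edge; it is `none` beyond the end of the list. -/
inductive Answer (n : ℕ) where
  | node (v : Fin n)
  | degree (d : ℕ)
  | entry (x : Option (Fin n × ℝ))
  | written

/-- A randomized algorithm on networks with `n` nodes. It is given the adversary node; everything
else about the network has to be found out by basic operations. Arbitrary internal computation and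
internal random choices between two basic operations are free of charge, and nodes may be addressed
by name, so that lower bounds on the number of basic operations are lower bounds on running time. -/
structure Algorithm (n : ℕ) where
  State : Type
  init : Fin n → PMF State
  op : State → Op n
  next : State → Answer n → PMF State

namespace Algorithm

variable {n : ℕ}

/-- An internal state together with the set of nodes written so far. -/
abbrev Config (A : Algorithm n) := A.State × Finset (Fin n)

/-- One step of the algorithm on the network `I`. -/
def step (A : Algorithm n) (I : Network n) (c : A.Config) : PMF A.Config :=
  haveI : Nonempty (Fin n) := ⟨I.vc⟩
  let continueWith : Answer n → Finset (Fin n) → PMF A.Config :=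
    fun a S => (A.next c.1 a).map fun s => (s, S)
  match A.op c.1 with
  | .halt => PMF.pure c
  | .sample => (PMF.uniformOfFintype (Fin n)).bind fun v => continueWith (.node v) c.2
  | .outDegree v => continueWith (.degree (I.outList v).length) c.2
  | .inDegree v => continueWith (.degree (I.inList v).length) c.2
  | .outEntry v i => continueWith (.entry ((I.outList v)[i]?.map fun w => (w, I.pC (v, w)))) c.2
  | .inEntry v i => continueWith (.entry ((I.inList v)[i]?.map fun u => (u, I.pC (u, v)))) c.2
  | .write v => continueWith .written (insert v c.2)

/-- The distribution of the configuration after `t` steps. -/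
def run (A : Algorithm n) (I : Network n) : ℕ → PMF A.Config
  | 0 => (A.init I.vc).map fun s => (s, ∅)
  | t + 1 => (A.run I t).bind (A.step I)

/-- The expected running time `∑ₜ ℙ(not halted after t steps)`. -/
def expectedTime (A : Algorithm n) (I : Network n) : ℝ≥0∞ :=
  ∑' t : ℕ, (A.run I t).toOuterMeasure {c | A.op c.1 ≠ .halt}

/-- The probability that the algorithm halts and has written a `β`-approximate seed set. -/
def successProb (A : Algorithm n) (I : Network n) (k : ℕ) (β : ℝ) : ℝ≥0∞ :=
  ⨆ t : ℕ, (A.run I t).toOuterMeasure {c | A.op c.1 = .halt ∧ I.IsApprox k β c.2}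

/-- On every network with `m` edges the algorithm returns a `β`-approximate seed set with
probability at least `p`. -/
def Solves (A : Algorithm n) (m k : ℕ) (β p : ℝ) : Prop :=
  ∀ I : Network n, I.numEdges = m → ENNReal.ofReal p ≤ A.successProb I k β

end Algorithm

end EIL

end

noncomputable section

namespace EIL

/-! The proof hides one edge. In a base network `C` never crosses any candidate edge; each variant
makes one candidate certain. Adjacency lists are shared, so the runs differ only if the modified
edge is read (`expect_run_le`), and one operation reads at most one edge. Hence
(`sum_successProb_le`) the success probabilities over all variants sum to at most the expected time
on the base network plus the expected number of variants that its output serves. The base network is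
the slow instance; success on it is never used.

It remains to choose variants of which no output serves many. For m = n - 1 the candidates are the
edges of a star at the adversary: a good set contains the hidden endpoint, so it serves at most as
many variants as it has nodes, and writing these takes time as well. For larger m there are q = 16k
blocks, each a complete bipartite graph from a sources to b hubs, with R ≥ k/β leaves at every hub.
Seeds outside the block of the hidden edge save at most themselves (`prevention_le_card`), while a
seed at the hidden hub saves R + 1 nodes (`le_prevention`). So a good set meets that block, and k
seeds serve at most kab of the qab variants. Filler nodes, disconnected from the rest, adjust n and
m. Both bounds are linear in m + n without the factor β / min{k, 1/β} ≤ 1. -/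

/-! ### Expectations with respect to probability mass functions -/

/-- The expectation of `f` with respect to `μ`. -/
def expect {α : Type*} (μ : PMF α) (f : α → ℝ≥0∞) : ℝ≥0∞ := ∑' a, μ a * f a

section Expect

variable {α γ : Type*}

lemma expect_pure (a : α) (f : α → ℝ≥0∞) : expect (PMF.pure a) f = f a := by
  unfold expect
  rw [tsum_eq_single a]
  · simp
  · intro b hb
    simp [PMF.pure_apply, hb]

lemma expect_bind (μ : PMF α) (κ : α → PMF γ) (f : γ → ℝ≥0∞) :
    expect (μ.bind κ) f = expect μ fun a => expect (κ a) f := by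
  unfold expect
  simp_rw [PMF.bind_apply, ← ENNReal.tsum_mul_right, ← ENNReal.tsum_mul_left]
  rw [ENNReal.tsum_comm]
  simp_rw [mul_assoc]

lemma expect_map (μ : PMF α) (g : α → γ) (f : γ → ℝ≥0∞) :
    expect (μ.map g) f = expect μ fun a => f (g a) := by
  simp only [PMF.map, expect_bind, Function.comp_apply, expect_pure]

lemma expect_const (μ : PMF α) (c : ℝ≥0∞) : expect μ (fun _ => c) = c := by
  simp [expect, ENNReal.tsum_mul_right, μ.tsum_coe]

lemma expect_mono (μ : PMF α) {f g : α → ℝ≥0∞} (h : ∀ a, f a ≤ g a) : expect μ f ≤ expect μ g :=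
  ENNReal.tsum_le_tsum fun a => mul_le_mul_right (h a) _

lemma expect_add (μ : PMF α) (f g : α → ℝ≥0∞) :
    expect μ (fun a => f a + g a) = expect μ f + expect μ g := by
  simp only [expect, mul_add, ENNReal.tsum_add]

lemma expect_sum {ι : Type*} (s : Finset ι) (μ : PMF α) (f : ι → α → ℝ≥0∞) :
    expect μ (fun a => ∑ i ∈ s, f i a) = ∑ i ∈ s, expect μ (f i) := by
  simp only [expect, Finset.mul_sum]
  exact Summable.tsum_finsetSum fun i _ => ENNReal.summable

lemma expect_le_of_le (μ : PMF α) {f : α → ℝ≥0∞} {c : ℝ≥0∞} (h : ∀ a, f a ≤ c) :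
    expect μ f ≤ c :=
  (expect_mono μ h).trans_eq (expect_const μ c)

open Classical in
lemma toOuterMeasure_eq_expect (μ : PMF α) (s : Set α) :
    μ.toOuterMeasure s = expect μ fun a => if a ∈ s then 1 else 0 := by
  rw [PMF.toOuterMeasure_apply]
  exact tsum_congr fun a => by by_cases h : a ∈ s <;> simp [h]

end Expect

/-! ### Comparing the runs of an algorithm on similar networks -/

/-- The edge whose propagation probability the operation reads. -/
def Network.probe {n : ℕ} (I : Network n) : Op n → Option (Fin n × Fin n)
  | .outEntry v i => (I.outList v)[i]?.map fun w => (v, w)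
  | .inEntry v i => (I.inList v)[i]?.map fun u => (u, v)
  | _ => none

/-- The two networks have the same adversary node and the same adjacency lists, and their
propagation probabilities agree except possibly on the edge `e`. -/
structure Network.AgreeOff {n : ℕ} (I J : Network n) (e : Fin n × Fin n) : Prop where
  vc : J.vc = I.vc
  outList : J.outList = I.outList
  inList : J.inList = I.inList
  pC : ∀ x, x ≠ e → J.pC x = I.pC x

namespace Algorithm

variable {n : ℕ} (A : Algorithm n)

/-- Degrees and neighbours are shared, so only an answer that carries the probability of `e` can
differ. -/
lemma step_congr {I J : Network n} {e : Fin n × Fin n} (h : I.AgreeOff J e) (c : A.Config)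
    (hc : I.probe (A.op c.1) ≠ some e) : A.step J c = A.step I c := by
  unfold step
  cases hop : A.op c.1 with
  | halt | sample | write => rfl
  | outDegree v => simp only [h.outList]
  | inDegree v => simp only [h.inList]
  | outEntry v i =>
    simp only [h.outList]
    cases hl : (I.outList v)[i]? with
    | none => rfl
    | some w =>
      have : (v, w) ≠ e := by simpa [hop, Network.probe, hl] using hc
      simp [h.pC _ this]
  | inEntry v i =>
    simp only [h.inList]
    cases hl : (I.inList v)[i]? with
    | none => rfl
    | some u =>
      have : (u, v) ≠ e := by simpa [hop, Network.probe, hl] using hc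
      simp [h.pC _ this]

open Classical in
/-- The probability that the operation performed after `t` steps reads the edge `e`. -/
def probeProb (I : Network n) (e : Fin n × Fin n) (t : ℕ) : ℝ≥0∞ :=
  expect (A.run I t) fun c => if I.probe (A.op c.1) = some e then 1 else 0

/-- Runs on two networks that differ in one edge can be told apart only if that edge is read. -/
lemma expect_run_le {I J : Network n} {e : Fin n × Fin n} (h : I.AgreeOff J e) (t : ℕ)
    (f : A.Config → ℝ≥0∞) (hf : ∀ c, f c ≤ 1) :
    expect (A.run J t) f ≤ expect (A.run I t) f + ∑ s ∈ Finset.range t, A.probeProb I e s := by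
  classical
  induction t generalizing f with
  | zero => simp [run, h.vc]
  | succ t ih =>
    simp only [run, expect_bind]
    -- Hybrid argument: replace the first `t` steps by induction, with the last step on `J` absorbed
    -- into the test function, then replace that step.
    refine (ih _ fun c => expect_le_of_le _ hf).trans ?_
    rw [Finset.sum_range_succ, add_comm (∑ s ∈ Finset.range t, _), ← add_assoc]
    gcongr
    rw [probeProb, ← expect_add]
    refine expect_mono _ fun c => ?_
    split_ifs with hc
    · exact (expect_le_of_le _ hf).trans le_add_self
    · rw [A.step_congr h c hc, add_zero]

/-- The probability that the algorithm has not halted after `t` steps. -/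
def activeProb (I : Network n) (t : ℕ) : ℝ≥0∞ :=
  (A.run I t).toOuterMeasure {c | A.op c.1 ≠ .halt}

lemma sum_activeProb_le (I : Network n) (t : ℕ) :
    ∑ s ∈ Finset.range t, A.activeProb I s ≤ A.expectedTime I :=
  ENNReal.sum_le_tsum _

/-- An operation reads at most one edge. -/
lemma sum_probeProb_le {ι : Type*} [Fintype ι] (I : Network n) {e : ι → Fin n × Fin n}
    (he : Function.Injective e) (t : ℕ) :
    ∑ i, A.probeProb I (e i) t ≤ A.activeProb I t := by
  classical
  unfold probeProb activeProb
  rw [← expect_sum, toOuterMeasure_eq_expect]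
  refine expect_mono _ fun c => ?_
  by_cases hc : A.op c.1 = .halt
  · simp [hc, Network.probe]
  · have : (Finset.univ.filter fun i => I.probe (A.op c.1) = some (e i)).card ≤ 1 := by
      rw [Finset.card_le_one]
      intro i hi j hj
      simp only [Finset.mem_filter, Finset.mem_univ, true_and] at hi hj
      exact he (Option.some_injective _ (hi.symm.trans hj))
    simpa [hc] using this

/-- Halted configurations are fixed points of the step. Monotonicity lets a finite sum of suprema be
taken at a common time. -/
lemma monotone_halt_prob (I : Network n) (P : Finset (Fin n) → Prop) :
    Monotone fun t => (A.run I t).toOuterMeasure {c | A.op c.1 = .halt ∧ P c.2} := by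
  classical
  refine monotone_nat_of_le_succ fun t => ?_
  simp only [toOuterMeasure_eq_expect, run, expect_bind]
  refine expect_mono _ fun c => ?_
  split_ifs with hc
  · have hstep : A.step I c = PMF.pure c := by
      unfold step
      rw [hc.1]
    rw [hstep, expect_pure, if_pos hc]
  · exact zero_le

open Classical in
/-- If one of finitely many edges is modified, the algorithm either reads the modified edge or
returns what it returns on the original network. -/
theorem sum_successProb_le {ι : Type*} [Fintype ι] (I : Network n) (J : ι → Network n)
    {e : ι → Fin n × Fin n} (he : Function.Injective e) (h : ∀ i, I.AgreeOff (J i) (e i))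
    (k : ℕ) (β : ℝ) :
    ∑ i, A.successProb (J i) k β ≤ A.expectedTime I +
      ⨆ t, expect (A.run I t) fun c =>
        ((Finset.univ.filter fun i => (J i).IsApprox k β c.2).card : ℝ≥0∞) := by
  unfold successProb
  rw [ENNReal.finsetSum_iSup_of_monotone fun i => A.monotone_halt_prob (J i) _]
  refine iSup_le fun t => ?_
  have hrun (i : ι) : (A.run (J i) t).toOuterMeasure
        {c | A.op c.1 = .halt ∧ (J i).IsApprox k β c.2} ≤
      expect (A.run I t) (fun c => if (J i).IsApprox k β c.2 then 1 else 0) +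
        ∑ s ∈ Finset.range t, A.probeProb I (e i) s := by
    rw [toOuterMeasure_eq_expect]
    refine (A.expect_run_le (h i) t _ fun c => by split_ifs <;> simp).trans ?_
    gcongr
    -- Halting is no longer required: the later bounds on the number of served variants also cover
    -- partial outputs.
    refine expect_mono _ fun c => ?_
    by_cases hc : (J i).IsApprox k β c.2
    · simp only [hc, if_true]
      split_ifs <;> simp
    · simp [hc]
  refine (Finset.sum_le_sum fun i _ => hrun i).trans ?_
  rw [Finset.sum_add_distrib, add_comm, Finset.sum_comm, ← expect_sum]
  gcongr
  · exact (Finset.sum_le_sum fun s _ => A.sum_probeProb_le I he s).trans (A.sum_activeProb_le I t)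
  · refine le_trans (le_of_eq ?_) (le_iSup _ t)
    simp

/-- Writing a node costs one unit of time. -/
lemma expect_card_output_le (I : Network n) (t : ℕ) :
    expect (A.run I t) (fun c => (c.2.card : ℝ≥0∞)) ≤ A.expectedTime I := by
  classical
  refine le_trans ?_ (A.sum_activeProb_le I t)
  induction t with
  | zero => simp [run, expect_map, expect_const]
  | succ t ih =>
    rw [Finset.sum_range_succ]
    refine le_trans ?_ (add_le_add_left ih _)
    rw [activeProb, toOuterMeasure_eq_expect, ← expect_add, run, expect_bind]
    refine expect_mono _ fun c => ?_
    unfold step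
    cases hop : A.op c.1 with
    | halt => simp [expect_pure]
    | sample => simp [expect_bind, expect_map, expect_const, hop]
    | outDegree | inDegree | outEntry | inEntry => simp [expect_map, expect_const, hop]
    | write v =>
      simp only [expect_map, expect_const, Set.mem_ofPred_eq, hop]
      simpa using (by exact_mod_cast Finset.card_insert_le v c.2 :
        ((insert v c.2).card : ℝ≥0∞) ≤ (c.2.card : ℝ≥0∞) + 1)

end Algorithm

/-! ### The cascade -/

section Cascade

variable {n : ℕ} {E g : Finset (Fin n × Fin n)} {a : Status n}

lemma fst_iterate_mono (a : Status n) :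
    Monotone fun t => ((cascadeStep E g)^[t] a).1 :=
  monotone_nat_of_le_succ fun t => by
    simp only [Function.iterate_succ_apply']
    exact Finset.subset_union_left

lemma snd_subset_iterate (a : Status n) (t : ℕ) : a.2 ⊆ ((cascadeStep E g)^[t] a).2 := by
  induction t with
  | zero => rfl
  | succ t ih =>
    rw [Function.iterate_succ_apply']
    exact ih.trans Finset.subset_union_left

/-- Campaign `C` stays within a set that realized edges leave only towards the seeds of `L`. -/
lemma fst_iterate_subset {Q : Finset (Fin n)} (h₀ : a.1 ⊆ Q)
    (hQ : ∀ u v, (u, v) ∈ g → u ∈ Q → v ∈ Q ∨ v ∈ a.2) (t : ℕ) :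
    ((cascadeStep E g)^[t] a).1 ⊆ Q := by
  induction t with
  | zero => exact h₀
  | succ t ih =>
    rw [Function.iterate_succ_apply']
    refine Finset.union_subset ih fun v hv => ?_
    simp only [newC, Finset.mem_filter, Finset.mem_univ, true_and] at hv
    obtain ⟨-, hL, -, u, hu, huv⟩ := hv
    exact (hQ u v huv (ih hu)).resolve_right fun h => hL (snd_subset_iterate a t h)

/-- Campaign `L` never enters a set without seeds of `L` whose in-neighbours outside the set start
in `C`. -/
lemma snd_iterate_disjoint {P : Set (Fin n)} (h₀ : ∀ v ∈ a.2, v ∉ P) (h₁ : ∀ v ∈ a.2, v ∉ a.1)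
    (hP : ∀ u v, (u, v) ∈ E → v ∈ P → u ∈ P ∨ u ∈ a.1) (t : ℕ) :
    ∀ v ∈ ((cascadeStep E g)^[t] a).2, v ∉ P ∧ v ∉ a.1 := by
  induction t with
  | zero => exact fun v hv => ⟨h₀ v hv, h₁ v hv⟩
  | succ t ih =>
    intro v hv
    rw [Function.iterate_succ_apply'] at hv
    rcases Finset.mem_union.1 hv with hv | hv
    · exact ih v hv
    · simp only [newL, Finset.mem_filter, Finset.mem_univ, true_and] at hv
      obtain ⟨hC, -, u, hu, huv⟩ := hv
      refine ⟨fun h => ?_, fun h => hC (fst_iterate_mono a (Nat.zero_le t) h)⟩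
      rcases hP u v huv h with h | h
      · exact (ih u hu).1 h
      · exact (ih u hu).2 h

/-- Campaign `C` propagates along realized edges to nodes that campaign `L` does not take. -/
lemma mem_fst_iterate_succ {u v : Fin n} {t : ℕ} (hu : u ∈ ((cascadeStep E g)^[t] a).1)
    (huv : (u, v) ∈ g) (hv : v ∉ ((cascadeStep E g)^[t + 1] a).2) :
    v ∈ ((cascadeStep E g)^[t + 1] a).1 := by
  rw [Function.iterate_succ_apply'] at hv ⊢
  -- Absence from `L` is assumed at time `t + 1` because `L` wins ties.
  simp only [cascadeStep, Finset.mem_union, not_or] at hv ⊢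
  by_cases hC : v ∈ ((cascadeStep E g)^[t] a).1
  · exact Or.inl hC
  · refine Or.inr ?_
    simp only [newC, Finset.mem_filter, Finset.mem_univ, true_and]
    exact ⟨hC, hv.1, hv.2, u, hu, huv⟩

end Cascade

/-! ### Networks on which campaign `C` propagates deterministically -/

section CertainNetwork

variable {n : ℕ}

/-- The network in which campaign `C` propagates along the edges of `K` and along no others. -/
def certainNetwork (vc : Fin n) (E : Finset (Fin n × Fin n)) (hE : ∀ v, (v, v) ∉ E)
    (K : Finset (Fin n × Fin n)) : Network n where
  vc := vc
  edges := E
  loopless := hE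
  pC e := if e ∈ K then 1 else 0
  pC_mem e := by split_ifs <;> simp
  outList u := (Finset.univ.filter fun v => (u, v) ∈ E).toList
  outList_nodup u := Finset.nodup_toList _
  mem_outList u v := by simp
  inList v := (Finset.univ.filter fun u => (u, v) ∈ E).toList
  inList_nodup v := Finset.nodup_toList _
  mem_inList u v := by simp

variable {vc : Fin n} {E : Finset (Fin n × Fin n)} {hE : ∀ v, (v, v) ∉ E}
  {K : Finset (Fin n × Fin n)}

/-- The realization is almost surely `K`: any other set omits an edge of probability 1 or contains
one of probability 0. -/
lemma expectedPrevention_certainNetwork (hK : K ⊆ E) (S : Finset (Fin n)) :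
    (certainNetwork vc E hE K).expectedPrevention S =
      ((certainNetwork vc E hE K).prevention K S : ℝ) := by
  unfold Network.expectedPrevention
  rw [Finset.sum_eq_single_of_mem K (show K ∈ (certainNetwork vc E hE K).edges.powerset from
    Finset.mem_powerset.2 hK)]
  · have h₁ : ∏ e ∈ K, (certainNetwork vc E hE K).pC e = 1 :=
      Finset.prod_eq_one fun e he => if_pos he
    have h₂ : ∏ e ∈ E \ K, (1 - (certainNetwork vc E hE K).pC e) = 1 :=
      Finset.prod_eq_one fun e he => by
        simp [certainNetwork, (Finset.mem_sdiff.1 he).2]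
    have h₃ : (certainNetwork vc E hE K).realizationProb K = 1 := by
      unfold Network.realizationProb
      rw [h₁, one_mul]
      exact h₂
    rw [h₃, one_mul]
  · intro g hg hgK
    refine mul_eq_zero_of_left ?_ _
    unfold Network.realizationProb
    by_cases h : g ⊆ K
    · obtain ⟨e, heK, heg⟩ := Finset.exists_of_ssubset (h.ssubset_of_ne hgK)
      refine mul_eq_zero_of_right _ (Finset.prod_eq_zero (i := e) ?_ ?_)
      · exact Finset.mem_sdiff.2 ⟨hK heK, heg⟩
      · simp [certainNetwork, heK]
    · obtain ⟨e, heg, heK⟩ := Finset.not_subset.1 h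
      exact mul_eq_zero_of_left (Finset.prod_eq_zero heg (if_neg heK)) _

/-- Competing seed sets have exactly `k` nodes, so a useful seed must be padded without using `vc`.
-/
lemma exists_seedSet {k : ℕ} (hk : 1 ≤ k) (hkn : k < n) {u : Fin n} (hu : u ≠ vc) :
    ∃ S : Finset (Fin n), vc ∉ S ∧ S.card = k ∧ u ∈ S := by
  obtain ⟨S, h₁, h₂, h₃⟩ := Finset.exists_subsuperset_card_eq (s := {u})
    (t := Finset.univ.erase vc) (n := k) (by simpa using hu) (by simpa using hk)
    (by simp; omega)
  exact ⟨S, fun h => by simpa using h₂ h, h₃, by simpa using h₁⟩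

end CertainNetwork

/-! ### Hiding the only certain edge among the edges of a star -/

section Star

variable {n : ℕ}

/-- The edges from `vc` to all other nodes. -/
def starEdges (vc : Fin n) : Finset (Fin n × Fin n) :=
  (Finset.univ.erase vc).map ⟨fun v => (vc, v), fun _ _ h => (Prod.ext_iff.1 h).2⟩

lemma mem_starEdges {vc u v : Fin n} : (u, v) ∈ starEdges vc ↔ u = vc ∧ v ≠ vc := by
  simp only [starEdges, Finset.mem_map, Finset.mem_erase, Finset.mem_univ, and_true]
  constructor
  · rintro ⟨w, hw, h⟩
    obtain ⟨rfl, rfl⟩ := Prod.ext_iff.1 h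
    exact ⟨rfl, hw⟩
  · rintro ⟨rfl, hv⟩
    exact ⟨v, hv, rfl⟩

lemma card_starEdges (vc : Fin n) : (starEdges vc).card = n - 1 := by
  simp [starEdges]

lemma starEdges_loopless (vc v : Fin n) : (v, v) ∉ starEdges vc := by
  rw [mem_starEdges]
  exact fun h => h.2 h.1

/-- The star in which campaign `C` propagates along the edges of `K` only. -/
def starNetwork (vc : Fin n) (K : Finset (Fin n × Fin n)) : Network n :=
  certainNetwork vc (starEdges vc) (starEdges_loopless vc) K

/-- Only `u` can be saved, and only by seeding it: otherwise the prevention is 0, against at least 1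
for a set containing `u`. -/
lemma mem_of_isApprox_starNetwork {k : ℕ} (hk : 1 ≤ k) (hkn : k < n) {β : ℝ} (hβ : 0 < β)
    {vc u : Fin n} (hu : u ≠ vc) {S : Finset (Fin n)}
    (h : (starNetwork vc {(vc, u)}).IsApprox k β S) : u ∈ S := by
  obtain ⟨hvc, -, h⟩ := h
  change vc ∉ S at hvc
  have hK : {(vc, u)} ⊆ starEdges vc := by simpa [mem_starEdges] using hu
  have hn : 1 ≤ n := by omega
  have hadopt (T : Finset (Fin n)) (hT : vc ∉ T) (huT : u ∉ T) :
      u ∈ (starNetwork vc {(vc, u)}).adoptC {(vc, u)} T := by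
    refine fst_iterate_mono _ hn (mem_fst_iterate_succ (t := 0) (u := vc) ?_ ?_ fun hL => ?_)
    · exact Finset.mem_singleton_self vc
    · exact Finset.mem_singleton_self _
    · refine (snd_iterate_disjoint (P := {u}) ?_ ?_ ?_ 1 u hL).1 rfl
      · rintro v hv rfl
        exact huT hv
      · intro v hv hv'
        obtain rfl : v = vc := Finset.mem_singleton.1 hv'
        exact hT hv
      · intro x y hxy _
        exact Or.inr (Finset.mem_singleton.2 (mem_starEdges.1 hxy).1)
  obtain ⟨S', hvc', hcard', huS'⟩ := exists_seedSet hk hkn hu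
  have hopt : 1 ≤ (starNetwork vc {(vc, u)}).prevention {(vc, u)} S' := by
    refine Finset.card_pos.2 ⟨u, Finset.mem_sdiff.2 ⟨hadopt ∅ (by simp) (by simp), fun hC => ?_⟩⟩
    -- The confining set is everything but `u`: the only realized edge ends at a seed of `L`.
    refine Finset.notMem_erase u Finset.univ (fst_iterate_subset ?_ ?_ n hC)
    · simpa [starNetwork, certainNetwork] using hu.symm
    · intro x y hxy _
      obtain ⟨-, rfl⟩ : x = vc ∧ y = u := by simpa using hxy
      exact Or.inr huS'
  by_contra huS
  have hzero : (starNetwork vc {(vc, u)}).prevention {(vc, u)} S = 0 := by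
    refine Finset.card_eq_zero.2 (Finset.sdiff_eq_empty_iff_subset.2 ?_)
    refine (fst_iterate_subset (Q := {vc, u}) ?_ ?_ n).trans ?_
    · simp [starNetwork, certainNetwork]
    · intro x y hxy _
      obtain ⟨-, rfl⟩ : x = vc ∧ y = u := by simpa using hxy
      simp
    · intro v hv
      rcases Finset.mem_insert.1 hv with rfl | hv
      · exact fst_iterate_mono _ (Nat.zero_le n) (Finset.mem_singleton_self _)
      · rw [Finset.mem_singleton.1 hv]
        exact hadopt S hvc huS
  have := h S' hvc' hcard'
  unfold starNetwork at this hzero hopt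
  rw [expectedPrevention_certainNetwork hK, expectedPrevention_certainNetwork hK, hzero] at this
  have hopt' : (1 : ℝ) ≤ ((certainNetwork vc (starEdges vc) (starEdges_loopless vc)
    {(vc, u)}).prevention {(vc, u)} S' : ℝ) := by exact_mod_cast hopt
  push_cast at this
  nlinarith

end Star

/-! ### Hiding one certain edge in disjoint complete bipartite graphs -/

section Blocks

/-- The nodes of the block network: the adversary `root`, in each of `q` blocks `a` sources and `b`
hubs with `R` leaves each, and `f` filler nodes. -/
inductive Site (q a b R f : ℕ) where
  | root
  | source (j : Fin q) (x : Fin a)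
  | hub (j : Fin q) (y : Fin b)
  | leaf (j : Fin q) (y : Fin b) (r : Fin R)
  | filler (i : Fin f)

namespace Site

variable {q a b R f : ℕ}

/-- Sites as a sum type. -/
def equivSum : Site q a b R f ≃
    Unit ⊕ (Fin q × Fin a) ⊕ (Fin q × Fin b) ⊕ (Fin q × Fin b × Fin R) ⊕ Fin f where
  toFun
    | root => .inl ()
    | source j x => .inr (.inl (j, x))
    | hub j y => .inr (.inr (.inl (j, y)))
    | leaf j y r => .inr (.inr (.inr (.inl (j, y, r))))
    | filler i => .inr (.inr (.inr (.inr i)))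
  invFun
    | .inl _ => root
    | .inr (.inl (j, x)) => source j x
    | .inr (.inr (.inl (j, y))) => hub j y
    | .inr (.inr (.inr (.inl (j, y, r)))) => leaf j y r
    | .inr (.inr (.inr (.inr i))) => filler i
  left_inv s := by cases s <;> rfl
  right_inv s := by rcases s with _ | _ | _ | _ | _ <;> rfl

instance : Fintype (Site q a b R f) := Fintype.ofEquiv _ equivSum.symm

lemma card : Fintype.card (Site q a b R f) = 1 + (q * a + (q * b + (q * (b * R) + f))) := by
  rw [Fintype.card_congr equivSum]
  simp

/-- The block of a site. -/
def block : Site q a b R f → Option (Fin q)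
  | source j _ => some j
  | hub j _ => some j
  | leaf j _ _ => some j
  | _ => none

end Site

variable {q a b R f n : ℕ} (φ : Site q a b R f ≃ Fin n)

/-- The edges from the root to the sources. -/
def rootEdges : Finset (Fin n × Fin n) :=
  Finset.univ.image fun i : Fin q × Fin a => (φ .root, φ (.source i.1 i.2))

/-- The edge from a source to a hub of the same block. -/
def hubEdge (i : Fin q × Fin a × Fin b) : Fin n × Fin n :=
  (φ (.source i.1 i.2.1), φ (.hub i.1 i.2.2))

/-- The edges from the sources to the hubs of their block. -/
def hubEdges : Finset (Fin n × Fin n) := Finset.univ.image (hubEdge φ)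

/-- The edges from the hubs to their leaves. -/
def leafEdges : Finset (Fin n × Fin n) :=
  Finset.univ.image fun i : Fin q × Fin b × Fin R =>
    (φ (.hub i.1 i.2.1), φ (.leaf i.1 i.2.1 i.2.2))

/-- All edges between filler nodes. -/
def fillerEdges : Finset (Fin n × Fin n) :=
  (Finset.univ.image fun i : Fin f => φ (.filler i)).offDiag

/-- The edges of the block network, of which the edges `F` between filler nodes can be chosen. -/
def blockEdges (F : Finset (Fin n × Fin n)) : Finset (Fin n × Fin n) :=
  (rootEdges φ ∪ hubEdges φ ∪ leafEdges φ) ∪ F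

lemma hubEdge_injective : Function.Injective (hubEdge φ) := by
  rintro ⟨j, x, y⟩ ⟨j', x', y'⟩ h
  simp only [hubEdge, Prod.mk.injEq, EmbeddingLike.apply_eq_iff_eq, Site.source.injEq,
    Site.hub.injEq] at h
  obtain ⟨⟨rfl, rfl⟩, -, rfl⟩ := h
  rfl

variable {φ} {F : Finset (Fin n × Fin n)}

lemma mem_fillerEdges {u v : Site q a b R f} :
    (φ u, φ v) ∈ fillerEdges φ ↔ ∃ i j, i ≠ j ∧ u = .filler i ∧ v = .filler j := by
  simp only [fillerEdges, Finset.mem_offDiag, Finset.mem_image, Finset.mem_univ, true_and,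
    EmbeddingLike.apply_eq_iff_eq, ne_eq]
  constructor
  · rintro ⟨⟨i, rfl⟩, ⟨j, rfl⟩, h⟩
    exact ⟨i, j, by simpa using h, rfl, rfl⟩
  · rintro ⟨i, j, h, rfl, rfl⟩
    exact ⟨⟨i, rfl⟩, ⟨j, rfl⟩, by simpa using h⟩

lemma card_fillerEdges : (fillerEdges φ).card = f * f - f := by
  rw [fillerEdges, Finset.offDiag_card, Finset.card_image_of_injective, Finset.card_univ,
    Fintype.card_fin]
  intro i j h
  simpa using h

lemma mem_rootEdges {u v : Site q a b R f} :
    (φ u, φ v) ∈ rootEdges φ ↔ ∃ j x, u = .root ∧ v = .source j x := by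
  simp [rootEdges, eq_comm]

lemma mem_hubEdges {u v : Site q a b R f} :
    (φ u, φ v) ∈ hubEdges φ ↔ ∃ j x y, u = .source j x ∧ v = .hub j y := by
  simp [hubEdges, hubEdge, eq_comm]

lemma mem_leafEdges {u v : Site q a b R f} :
    (φ u, φ v) ∈ leafEdges φ ↔ ∃ j y r, u = .hub j y ∧ v = .leaf j y r := by
  simp [leafEdges, eq_comm]

/-- The four kinds of edges of the block network. -/
lemma mem_blockEdges (hF : F ⊆ fillerEdges φ) {u v : Site q a b R f}
    (h : (φ u, φ v) ∈ blockEdges φ F) :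
    (∃ j x, u = .root ∧ v = .source j x) ∨ (∃ j x y, u = .source j x ∧ v = .hub j y) ∨
      (∃ j y r, u = .hub j y ∧ v = .leaf j y r) ∨
        ∃ i j, i ≠ j ∧ u = .filler i ∧ v = .filler j := by
  simp only [blockEdges, Finset.mem_union, or_assoc] at h
  rcases h with h | h | h | h
  · exact Or.inl (mem_rootEdges.1 h)
  · exact Or.inr (Or.inl (mem_hubEdges.1 h))
  · exact Or.inr (Or.inr (Or.inl (mem_leafEdges.1 h)))
  · exact Or.inr (Or.inr (Or.inr (mem_fillerEdges.1 (hF h))))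

lemma blockEdges_loopless (hF : F ⊆ fillerEdges φ) (v : Fin n) : (v, v) ∉ blockEdges φ F := by
  obtain ⟨u, rfl⟩ := φ.surjective v
  intro h
  rcases mem_blockEdges hF h with ⟨j, x, rfl, h⟩ | ⟨j, x, y, rfl, h⟩ | ⟨j, y, r, rfl, h⟩ |
    ⟨i, j, hij, rfl, h⟩
  · cases h
  · cases h
  · cases h
  · exact hij (by simpa using h)

variable (φ) in
/-- The filler edges can be chosen to give the block network any prescribed number of edges. -/
lemma exists_card_blockEdges {m : ℕ} (hm : q * a + q * a * b + q * b * R ≤ m)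
    (hf : m ≤ f * f - f) : ∃ F ⊆ fillerEdges φ, (blockEdges φ F).card = m := by
  set E₀ := rootEdges φ ∪ hubEdges φ ∪ leafEdges φ with hE₀
  have hcard : E₀.card ≤ m := by
    refine le_trans ?_ hm
    refine (Finset.card_union_le _ _).trans (add_le_add
      ((Finset.card_union_le _ _).trans (add_le_add ?_ ?_)) ?_)
    · exact Finset.card_image_le.trans (by simp)
    · exact Finset.card_image_le.trans (by simp [mul_assoc])
    · exact Finset.card_image_le.trans (by simp [mul_assoc])
  -- An upper bound on `E₀.card` suffices, as filler edges make up the exact difference.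
  obtain ⟨F, hF, hFcard⟩ := Finset.exists_subset_card_eq (s := fillerEdges φ) (n := m - E₀.card)
    (by rw [card_fillerEdges]; omega)
  refine ⟨F, hF, ?_⟩
  have hdisj : Disjoint E₀ F := by
    rw [Finset.disjoint_left]
    rintro ⟨u, v⟩ h₀ h
    obtain ⟨u, rfl⟩ := φ.surjective u
    obtain ⟨v, rfl⟩ := φ.surjective v
    obtain ⟨i, j, -, rfl, rfl⟩ := mem_fillerEdges.1 (hF h)
    simp only [hE₀, Finset.mem_union, mem_rootEdges, mem_hubEdges, mem_leafEdges] at h₀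
    simp at h₀
  rw [blockEdges, Finset.card_union_of_disjoint hdisj, hFcard]
  omega

/-- The block network in which campaign `C` propagates along the edges of `K` only. -/
def blockNetwork (hF : F ⊆ fillerEdges φ) (K : Finset (Fin n × Fin n)) : Network n :=
  certainNetwork (φ .root) (blockEdges φ F) (blockEdges_loopless hF) K

variable (φ) in
/-- The edges that are certain independently of the hidden edge. -/
def certainEdges : Finset (Fin n × Fin n) := rootEdges φ ∪ leafEdges φ

variable (φ) in
/-- The certain edges if the hidden edge is the one given by `i`. -/
def revealedEdges (i : Fin q × Fin a × Fin b) : Finset (Fin n × Fin n) :=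
  insert (hubEdge φ i) (certainEdges φ)

lemma revealedEdges_subset (i : Fin q × Fin a × Fin b) :
    revealedEdges φ i ⊆ blockEdges φ F := by
  intro e he
  simp only [revealedEdges, certainEdges, Finset.mem_insert, Finset.mem_union] at he
  simp only [blockEdges, Finset.mem_union]
  rcases he with rfl | he | he
  · exact Or.inl (Or.inl (Or.inr (Finset.mem_image_of_mem _ (Finset.mem_univ i))))
  · exact Or.inl (Or.inl (Or.inl he))
  · exact Or.inl (Or.inr he)

lemma mem_revealedEdges {i : Fin q × Fin a × Fin b} {u v : Site q a b R f} :
    (φ u, φ v) ∈ revealedEdges φ i ↔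
      (u = .source i.1 i.2.1 ∧ v = .hub i.1 i.2.2) ∨ (∃ j x, u = .root ∧ v = .source j x) ∨
        ∃ j y r, u = .hub j y ∧ v = .leaf j y r := by
  simp only [revealedEdges, certainEdges, Finset.mem_insert, Finset.mem_union, mem_rootEdges,
    mem_leafEdges, hubEdge, Prod.mk.injEq, EmbeddingLike.apply_eq_iff_eq]

variable (φ) in
/-- The hidden hub and its leaves. -/
def hiddenStar (i : Fin q × Fin a × Fin b) : Finset (Fin n) :=
  insert (φ (.hub i.1 i.2.2)) (Finset.univ.image fun r => φ (.leaf i.1 i.2.2 r))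

lemma card_hiddenStar (i : Fin q × Fin a × Fin b) : (hiddenStar φ i).card = R + 1 := by
  rw [hiddenStar, Finset.card_insert_of_notMem (by simp), Finset.card_image_of_injective,
    Finset.card_univ, Fintype.card_fin]
  intro r r' h
  simpa using h

variable (φ) in
/-- The nodes that campaign `C` reaches in the absence of `L`. -/
def reachedNodes (i : Fin q × Fin a × Fin b) : Finset (Fin n) :=
  insert (φ .root) (Finset.univ.image (fun p : Fin q × Fin a => φ (.source p.1 p.2)) ∪
    hiddenStar φ i)

/-- `reachedNodes` is closed under revealed edges: the hidden hub is its only hub, so no other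
leaves are entered. -/
lemma adoptC_empty_subset (hF : F ⊆ fillerEdges φ) (i : Fin q × Fin a × Fin b) :
    (blockNetwork hF (revealedEdges φ i)).adoptC (revealedEdges φ i) ∅ ⊆ reachedNodes φ i := by
  refine fst_iterate_subset ?_ ?_ n
  · simp [blockNetwork, certainNetwork, reachedNodes]
  · intro u v huv hu
    left
    obtain ⟨u, rfl⟩ := φ.surjective u
    obtain ⟨v, rfl⟩ := φ.surjective v
    rcases mem_revealedEdges.1 huv with ⟨rfl, rfl⟩ | ⟨j, x, rfl, rfl⟩ | ⟨j, y, r, rfl, rfl⟩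
    · simp [reachedNodes, hiddenStar]
    · simp [reachedNodes]
    · obtain ⟨rfl, rfl⟩ : j = i.1 ∧ y = i.2.2 := by simpa [reachedNodes, hiddenStar] using hu
      simp [reachedNodes, hiddenStar]

/-- Seeds outside the block of the hidden edge protect nothing but themselves. -/
lemma sdiff_subset_adoptC (hn : 3 ≤ n) (hF : F ⊆ fillerEdges φ) (i : Fin q × Fin a × Fin b)
    {S : Finset (Fin n)} (hvc : φ .root ∉ S) (hS : ∀ u, u.block = some i.1 → φ u ∉ S) :
    reachedNodes φ i \ S ⊆
      (blockNetwork hF (revealedEdges φ i)).adoptC (revealedEdges φ i) S := by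
  -- `L` enters neither the hidden block nor an unseeded source: the only in-neighbour of a source
  -- is the root, and hubs and leaves are entered from their own block.
  have hL (t : ℕ) (v : Site q a b R f)
      (hv : v.block = some i.1 ∨ (∃ j x, v = .source j x) ∧ φ v ∉ S) :
      φ v ∉ ((cascadeStep (blockEdges φ F) (revealedEdges φ i))^[t] ({φ .root}, S)).2 := by
    intro h
    refine (snd_iterate_disjoint (P := φ '' {v | v.block = some i.1 ∨
      (∃ j x, v = .source j x) ∧ φ v ∉ S}) ?_ ?_ ?_ t _ h).1 ⟨v, hv, rfl⟩
    · rintro _ hv ⟨w, hw | hw, rfl⟩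
      · exact hS w hw hv
      · exact hw.2 hv
    · intro v hv hv'
      obtain rfl : v = φ .root := Finset.mem_singleton.1 hv'
      exact hvc hv
    · rintro u _ huv ⟨v, hv, rfl⟩
      obtain ⟨u, rfl⟩ := φ.surjective u
      rcases mem_blockEdges hF huv with ⟨j, x, rfl, rfl⟩ | ⟨j, x, y, rfl, rfl⟩ |
        ⟨j, y, r, rfl, rfl⟩ | ⟨j, j', -, rfl, rfl⟩
      · simp
      · left
        exact ⟨_, Or.inl (by simpa [Site.block] using hv), rfl⟩
      · left
        exact ⟨_, Or.inl (by simpa [Site.block] using hv), rfl⟩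
      · simp [Site.block] at hv
  -- `C` now walks root, source, hub, leaf, which takes three steps; hence `3 ≤ n`.
  have hroot : φ .root ∈
      ((cascadeStep (blockEdges φ F) (revealedEdges φ i))^[0] ({φ .root}, S)).1 :=
    Finset.mem_singleton_self _
  have hsource (j : Fin q) (x : Fin a) (hx : φ (.source j x) ∉ S) : φ (.source j x) ∈
      ((cascadeStep (blockEdges φ F) (revealedEdges φ i))^[1] ({φ .root}, S)).1 :=
    mem_fst_iterate_succ hroot
      (mem_revealedEdges.2 (Or.inr (Or.inl ⟨j, x, rfl, rfl⟩)))
      (hL 1 _ (Or.inr ⟨⟨j, x, rfl⟩, hx⟩))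
  have hhub : φ (.hub i.1 i.2.2) ∈
      ((cascadeStep (blockEdges φ F) (revealedEdges φ i))^[2] ({φ .root}, S)).1 :=
    mem_fst_iterate_succ (hsource i.1 i.2.1 (hS _ rfl))
      (mem_revealedEdges.2 (Or.inl ⟨rfl, rfl⟩)) (hL 2 _ (Or.inl rfl))
  have hleaf (r : Fin R) : φ (.leaf i.1 i.2.2 r) ∈
      ((cascadeStep (blockEdges φ F) (revealedEdges φ i))^[3] ({φ .root}, S)).1 :=
    mem_fst_iterate_succ hhub
      (mem_revealedEdges.2 (Or.inr (Or.inr ⟨_, _, r, rfl, rfl⟩))) (hL 3 _ (Or.inl rfl))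
  intro v hv
  obtain ⟨hv, hvS⟩ := Finset.mem_sdiff.1 hv
  simp only [reachedNodes, hiddenStar, Finset.mem_insert, Finset.mem_union, Finset.mem_image,
    Finset.mem_univ, true_and] at hv
  rcases hv with rfl | ⟨p, rfl⟩ | rfl | ⟨r, rfl⟩
  · exact fst_iterate_mono _ (Nat.zero_le n) hroot
  · exact fst_iterate_mono _ (by omega : 1 ≤ n) (hsource p.1 p.2 hvS)
  · exact fst_iterate_mono _ (by omega : 2 ≤ n) hhub
  · exact fst_iterate_mono _ hn (hleaf r)

lemma prevention_le_card (hn : 3 ≤ n) (hF : F ⊆ fillerEdges φ) (i : Fin q × Fin a × Fin b)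
    {S : Finset (Fin n)} (hvc : φ .root ∉ S) (hS : ∀ u, u.block = some i.1 → φ u ∉ S) :
    (blockNetwork hF (revealedEdges φ i)).prevention (revealedEdges φ i) S ≤ S.card := by
  refine Finset.card_le_card fun v hv => ?_
  obtain ⟨h₁, h₂⟩ := Finset.mem_sdiff.1 hv
  by_contra hvS
  exact h₂ (sdiff_subset_adoptC hn hF i hvc hS
    (Finset.mem_sdiff.2 ⟨adoptC_empty_subset hF i h₁, hvS⟩))

/-- The hub is the only entrance to the hidden star along revealed edges, so a seed there keeps `C`
out of all of it. -/
lemma le_prevention (hn : 3 ≤ n) (hF : F ⊆ fillerEdges φ) (i : Fin q × Fin a × Fin b)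
    {S : Finset (Fin n)} (hS : φ (.hub i.1 i.2.2) ∈ S) :
    R + 1 ≤ (blockNetwork hF (revealedEdges φ i)).prevention (revealedEdges φ i) S := by
  rw [← card_hiddenStar (φ := φ) i]
  refine Finset.card_le_card fun v hv => Finset.mem_sdiff.2 ⟨?_, fun hC => ?_⟩
  -- With no seeds, this gives that all of `reachedNodes` adopts `C`.
  · refine sdiff_subset_adoptC hn hF i (by simp) (by simp) (Finset.mem_sdiff.2 ⟨?_, by simp⟩)
    exact Finset.mem_insert_of_mem (Finset.mem_union_right _ hv)
  · refine Finset.mem_compl.1 (fst_iterate_subset (Q := (hiddenStar φ i)ᶜ) ?_ ?_ n hC) hv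
    · simp [blockNetwork, certainNetwork, hiddenStar]
    · intro u v huv hu
      obtain ⟨u, rfl⟩ := φ.surjective u
      obtain ⟨v, rfl⟩ := φ.surjective v
      rcases mem_revealedEdges.1 huv with ⟨rfl, rfl⟩ | ⟨j, x, rfl, rfl⟩ | ⟨j, y, r, rfl, rfl⟩
      · exact Or.inr hS
      · simp [hiddenStar]
      · left
        simp only [hiddenStar, Finset.mem_compl, Finset.mem_insert, Finset.mem_image,
          Finset.mem_univ, true_and, EmbeddingLike.apply_eq_iff_eq, Site.hub.injEq, reduceCtorEq,
          Site.leaf.injEq, exists_false, or_false, false_or, not_exists] at hu ⊢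
        exact fun r' h => hu ⟨h.1.symm, h.2.1.symm⟩

/-- An approximate seed set meets the block of the hidden edge. -/
lemma exists_mem_of_isApprox {k : ℕ} (hk : 1 ≤ k) (hkn : k < n) (hn : 3 ≤ n) {β : ℝ}
    (hβ : 0 < β) (hR : (k : ℝ) / β ≤ R) (hF : F ⊆ fillerEdges φ) (i : Fin q × Fin a × Fin b)
    {S : Finset (Fin n)} (h : (blockNetwork hF (revealedEdges φ i)).IsApprox k β S) :
    ∃ v ∈ S, (φ.symm v).block = some i.1 := by
  obtain ⟨hvc, hcard, h⟩ := h
  by_contra! hS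
  obtain ⟨S', hvc', hcard', hS'⟩ := exists_seedSet (vc := φ .root) hk hkn
    (u := φ (.hub i.1 i.2.2)) (by simp)
  have h₁ := h S' hvc' hcard'
  have h₂ := le_prevention hn hF i hS'
  have h₃ := (prevention_le_card hn hF i hvc fun u hu huS => hS _ huS (by simpa using hu)).trans
    hcard
  unfold blockNetwork at h₁ h₂ h₃
  rw [expectedPrevention_certainNetwork (revealedEdges_subset i),
    expectedPrevention_certainNetwork (revealedEdges_subset i)] at h₁
  have h₄ := (Nat.cast_le (α := ℝ)).2 h₂
  have h₅ := (Nat.cast_le (α := ℝ)).2 h₃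
  -- The hub itself gives strictness: β(R + 1) ≥ k + β > k.
  rw [div_le_iff₀ hβ] at hR
  push_cast at h₄
  nlinarith

-- At most `k` nodes meet at most `k` blocks, each with `a * b` candidate edges.
open Classical in
lemma card_isApprox_le {k : ℕ} (hk : 1 ≤ k) (hkn : k < n) (hn : 3 ≤ n) {β : ℝ}
    (hβ : 0 < β) (hR : (k : ℝ) / β ≤ R) (hF : F ⊆ fillerEdges φ) (S : Finset (Fin n)) :
    (Finset.univ.filter fun i : Fin q × Fin a × Fin b =>
      (blockNetwork hF (revealedEdges φ i)).IsApprox k β S).card ≤ k * (a * b) := by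
  by_cases hS : S.card ≤ k
  swap
  · rw [Finset.card_eq_zero.2]
    · exact Nat.zero_le _
    · exact Finset.filter_eq_empty_iff.2 fun i _ h => hS h.2.1
  set T : Finset (Fin q) := Finset.univ.filter fun j => ∃ v ∈ S, (φ.symm v).block = some j
  have hT : T.card ≤ k := by
    refine le_trans ?_ hS
    rw [← Finset.card_map Function.Embedding.some]
    refine (Finset.card_le_card (t := S.image fun v => (φ.symm v).block) ?_).trans
      Finset.card_image_le
    intro o ho
    obtain ⟨j, hj, rfl⟩ := Finset.mem_map.1 ho
    simpa [T] using hj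
  calc _ ≤ (T ×ˢ (Finset.univ : Finset (Fin a × Fin b))).card := by
        refine Finset.card_le_card fun i hi => ?_
        simpa [T] using exists_mem_of_isApprox hk hkn hn hβ hR hF i (Finset.mem_filter.1 hi).2
    _ ≤ k * (a * b) := by
        rw [Finset.card_product]
        simpa using Nat.mul_le_mul_right _ hT

end Blocks

/-- Sizes of the block network for prescribed numbers `n` of nodes and `m` of edges. -/
lemma exists_block_sizes {q R n m : ℕ} (hq : 1 ≤ q) (hn : 72 * (q * (1 + R)) + 24 ≤ n)
    (hnm : n - 1 ≤ m) (hm : 12 * (q * (1 + R)) * m ≤ n ^ 2) :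
    ∃ a b f : ℕ, 1 + (q * a + (q * b + (q * (b * R) + f))) = n ∧
      q * a + q * a * b + q * b * R ≤ m ∧ m ≤ f * f - f ∧ m ≤ 4 * (q * a * b) := by
  set W := q * (1 + R) with hW
  have hqW : q ≤ W := Nat.le_mul_of_pos_right q (by omega)
  have hqRW : q + q * R = W := by rw [hW]; ring
  set d := m / n with hd
  have hn0 : 0 < n := by omega
  have hdn : d * n ≤ m := Nat.div_mul_le_self m n
  have hdn' : m < (d + 1) * n := by
    rw [mul_comm]
    exact Nat.lt_mul_div_succ m hn0
  have hWd : 12 * W * d ≤ n := by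
    refine Nat.le_of_mul_le_mul_right (?_ : 12 * W * d * n ≤ n * n) hn0
    calc 12 * W * d * n = 12 * W * (d * n) := by ring
      _ ≤ 12 * W * m := Nat.mul_le_mul_left _ hdn
      _ ≤ n * n := by rw [← sq]; exact hm
  -- `b > m / n` keeps the number of sources below `n / 3`, and `b ≥ 3` keeps the root edges few
  -- compared with the hub edges.
  set b := d + 3 with hb
  -- The hub edges, which are the candidates, become about a third of all edges.
  set a := m / (3 * (q * b)) with ha
  have hqb : 0 < 3 * (q * b) := by positivity
  have ha₁ : a * (3 * (q * b)) ≤ m := Nat.div_mul_le_self m _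
  have ha₂ : m < (a + 1) * (3 * (q * b)) := by
    rw [mul_comm]
    exact Nat.lt_mul_div_succ m hqb
  have hWdm : 72 * W * d ≤ m := by
    refine le_trans ?_ hdn
    rw [mul_comm d n]
    exact Nat.mul_le_mul_right d (by omega)
  have hWb : W * b = W * d + 3 * W := by rw [hb]; ring
  have hqbW : q * b + q * b * R = W * b := by rw [← hqRW]; ring
  have hqab : q * a * b * 3 ≤ m := by
    calc q * a * b * 3 = a * (3 * (q * b)) := by ring
      _ ≤ m := ha₁
  have hqa : q * a * 9 ≤ m := by
    refine le_trans ?_ hqab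
    have : q * a * 3 ≤ q * a * b := Nat.mul_le_mul_left _ (Nat.le_add_left 3 d)
    omega
  have hqan : q * a * 3 ≤ n := by
    refine Nat.le_of_mul_le_mul_right (?_ : q * a * 3 * b ≤ n * b) (Nat.succ_pos _)
    calc q * a * 3 * b = q * a * b * 3 := by ring
      _ ≤ m := hqab
      _ ≤ (d + 1) * n := hdn'.le
      _ ≤ n * b := by rw [mul_comm n b]; exact Nat.mul_le_mul_right n (Nat.add_le_add_left (by norm_num) d)
  have e₁ : 12 * W * d = 12 * (W * d) := by ring
  have e₂ : 72 * W * d = 72 * (W * d) := by ring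
  -- About half of the nodes remain as filler, enough to host `m` edges.
  have hsize : 1 + (q * a + W * b) + n / 2 ≤ n := by omega
  refine ⟨a, b, n - (1 + (q * a + W * b)), ?_, ?_, ?_, ?_⟩
  · have : q * (b * R) = q * b * R := by ring
    omega
  · omega
  · set f := n - (1 + (q * a + W * b))
    have hf : n ≤ 2 * f + 1 := by omega
    have hW1 : 1 ≤ W := by omega
    have h₁ : 12 * m ≤ n ^ 2 := by nlinarith
    have h₂ : 12 ≤ f := by omega
    have : m + f ≤ f * f := by nlinarith
    omega
  · have h₁ : (a + 1) * (3 * (q * b)) = 3 * (q * a * b) + 3 * (q * b) := by ring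
    have h₂ : q * b ≤ W * b := Nat.mul_le_mul_right b hqW
    omega

/-! ### The lower bounds -/

lemma certainNetwork_agreeOff {n : ℕ} {vc : Fin n} {E : Finset (Fin n × Fin n)}
    {hE : ∀ v, (v, v) ∉ E} {K : Finset (Fin n × Fin n)} (e : Fin n × Fin n) :
    (certainNetwork vc E hE K).AgreeOff (certainNetwork vc E hE (insert e K)) e where
  vc := rfl
  outList := rfl
  inList := rfl
  pC x hx := by simp [certainNetwork, hx]

lemma le_successRate {ε : ℝ} (hε : ε < 1 / (10 * Real.exp 1)) :
    59 / 100 ≤ 1 - 1 / Real.exp 1 - ε := by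
  have he := Real.exp_one_gt_d9
  have h : 1 / Real.exp 1 ≤ 37 / 100 := by
    rw [div_le_div_iff₀ (Real.exp_pos 1) (by norm_num)]
    linarith
  have h' : 1 / (10 * Real.exp 1) = 1 / Real.exp 1 / 10 := by
    field_simp
  linarith

lemma bound_le {k : ℕ} (hk : 1 ≤ k) {β : ℝ} (hβ0 : 0 < β) (hβ1 : β ≤ 1) {N : ℝ} (hN : 0 ≤ N) :
    β * N / (24 * min (k : ℝ) (1 / β)) ≤ N / 24 := by
  have hmin : 1 ≤ min (k : ℝ) (1 / β) :=
    le_min (by exact_mod_cast hk) ((one_le_div hβ0).2 hβ1)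
  rw [div_le_div_iff₀ (by positivity) (by norm_num)]
  nlinarith [mul_le_mul_of_nonneg_right hβ1 hN, mul_le_mul_of_nonneg_left hmin hN]

/-- The expected time is charged twice, for reading candidates and for writing nodes; hence the
factor 1/2. -/
lemma starNetwork_expectedTime {k n : ℕ} (hk : 1 ≤ k) (hkn : k < n) {β p : ℝ} (hβ : 0 < β)
    (hp : 0 ≤ p) {A : Algorithm n} (hA : A.Solves (n - 1) k β p) (vc : Fin n) :
    ENNReal.ofReal (((n : ℝ) - 1) * p / 2) ≤ A.expectedTime (starNetwork vc ∅) := by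
  classical
  set I := starNetwork vc ∅
  -- `insert _ ∅` is the form that `certainNetwork_agreeOff` expects.
  let J : {v : Fin n // v ≠ vc} → Network n := fun v => starNetwork vc (insert (vc, v.1) ∅)
  have hinj : Function.Injective fun v : {v : Fin n // v ≠ vc} => (vc, v.1) :=
    fun v w h => Subtype.ext (Prod.ext_iff.1 h).2
  have hcard : Fintype.card {v : Fin n // v ≠ vc} = n - 1 := by simp
  have hsum := A.sum_successProb_le I J hinj (fun v => certainNetwork_agreeOff (vc, v.1)) k β
  have hright : ⨆ t, expect (A.run I t) (fun c =>
      ((Finset.univ.filter fun v => (J v).IsApprox k β c.2).card : ℝ≥0∞)) ≤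
      A.expectedTime I := by
    refine iSup_le fun t => (expect_mono _ fun c => ?_).trans (A.expect_card_output_le I t)
    refine Nat.cast_le.2 ?_
    rw [← Finset.card_map (Function.Embedding.subtype _)]
    refine Finset.card_le_card fun v hv => ?_
    obtain ⟨w, hw, rfl⟩ := Finset.mem_map.1 hv
    exact mem_of_isApprox_starNetwork hk hkn hβ w.2 (Finset.mem_filter.1 hw).2
  have hleft : (n - 1 : ℕ) * ENNReal.ofReal p ≤ ∑ v, A.successProb (J v) k β := by
    rw [← hcard, ← nsmul_eq_mul, ← Finset.card_univ]
    exact Finset.card_nsmul_le_sum _ _ _ fun v _ => hA (J v) (card_starEdges vc)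
  have htotal : (n - 1 : ℕ) * ENNReal.ofReal p ≤ A.expectedTime I + A.expectedTime I :=
    hleft.trans (hsum.trans (by gcongr))
  by_cases htop : A.expectedTime I = ⊤
  · simp [htop]
  · rw [ENNReal.ofReal_le_iff_le_toReal htop]
    have := ENNReal.toReal_mono (by simp [htop]) htotal
    rw [ENNReal.toReal_add htop htop, ENNReal.toReal_mul, ENNReal.toReal_natCast,
      ENNReal.toReal_ofReal hp, Nat.cast_sub (by omega)] at this
    push_cast at this
    linarith

/-- Guessing accounts for at most `k * (a * b)` of the total success; reading must supply the rest.
-/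
lemma blockNetwork_expectedTime {k n m q a b R f : ℕ} (hk : 1 ≤ k) (hkn : k < n) (hn : 3 ≤ n)
    {β p : ℝ} (hβ : 0 < β) (hp : 0 ≤ p) (hR : (k : ℝ) / β ≤ R)
    {A : Algorithm n} (hA : A.Solves m k β p) {φ : Site q a b R f ≃ Fin n}
    {F : Finset (Fin n × Fin n)} (hF : F ⊆ fillerEdges φ) (hm : (blockEdges φ F).card = m) :
    ENNReal.ofReal ((q * p - k) * (a * b)) ≤
      A.expectedTime (blockNetwork hF (certainEdges φ)) := by
  classical
  set I := blockNetwork hF (certainEdges φ)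
  let J : Fin q × Fin a × Fin b → Network n := fun i => blockNetwork hF (revealedEdges φ i)
  have hsum := A.sum_successProb_le I J (hubEdge_injective φ)
    (fun i => certainNetwork_agreeOff (hubEdge φ i)) k β
  have hright : ⨆ t, expect (A.run I t) (fun c =>
      ((Finset.univ.filter fun i => (J i).IsApprox k β c.2).card : ℝ≥0∞)) ≤
      (k * (a * b) : ℕ) :=
    iSup_le fun t => expect_le_of_le _ fun c =>
      Nat.cast_le.2 (card_isApprox_le hk hkn hn hβ hR hF c.2)
  have hleft : (q * (a * b) : ℕ) * ENNReal.ofReal p ≤ ∑ i, A.successProb (J i) k β := by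
    have hcard : Fintype.card (Fin q × Fin a × Fin b) = q * (a * b) := by simp
    rw [← hcard, ← nsmul_eq_mul, ← Finset.card_univ]
    exact Finset.card_nsmul_le_sum _ _ _ fun i _ => hA (J i) hm
  have htotal : (q * (a * b) : ℕ) * ENNReal.ofReal p ≤
      A.expectedTime I + (k * (a * b) : ℕ) :=
    hleft.trans (hsum.trans (by gcongr))
  by_cases htop : A.expectedTime I = ⊤
  · simp [htop]
  · rw [ENNReal.ofReal_le_iff_le_toReal htop]
    have := ENNReal.toReal_mono (ENNReal.add_ne_top.2 ⟨htop, ENNReal.natCast_ne_top _⟩) htotal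
    rw [ENNReal.toReal_add htop (ENNReal.natCast_ne_top _), ENNReal.toReal_mul,
      ENNReal.toReal_natCast, ENNReal.toReal_natCast, ENNReal.toReal_ofReal hp] at this
    push_cast at this
    linarith

end EIL

end

/-- Lower bound for eventual influence limitation, for all `n > k` on networks with `n - 1` edges,
and for fixed `k` and `β` and all large `n` on networks with any number of edges between `n - 1` and
a constant multiple of `n ^ 2`. -/
theorem theorem3 (k : ℕ) (hk : 1 ≤ k) (β : ℝ) (hβ0 : 0 < β) (hβ1 : β ≤ 1) :
    (∀ ε : ℝ, 0 < ε → ε < 1 / (10 * Real.exp 1) →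
      ∀ n : ℕ, k < n → ∀ A : EIL.Algorithm n,
        A.Solves (n - 1) k β (1 - 1 / Real.exp 1 - ε) →
          ∃ I : EIL.Network n, I.numEdges = n - 1 ∧
            ENNReal.ofReal (β * ((I.numEdges : ℝ) + n) / (24 * min (k : ℝ) (1 / β)))
              ≤ A.expectedTime I) ∧
    (∃ (c : ℝ) (n₀ : ℕ), 0 < c ∧
      ∀ ε : ℝ, 0 < ε → ε < 1 / (10 * Real.exp 1) →
        ∀ n m : ℕ, n₀ ≤ n → n - 1 ≤ m → (m : ℝ) ≤ c * (n : ℝ) ^ 2 → ∀ A : EIL.Algorithm n,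
          A.Solves m k β (1 - 1 / Real.exp 1 - ε) →
            ∃ I : EIL.Network n, I.numEdges = m ∧
              ENNReal.ofReal (β * ((I.numEdges : ℝ) + n) / (24 * min (k : ℝ) (1 / β)))
                ≤ A.expectedTime I) := by
  constructor
  · intro ε _ hε n hkn A hA
    have hp := EIL.le_successRate hε
    have hnum : (EIL.starNetwork (⟨0, by omega⟩ : Fin n) ∅).numEdges = n - 1 :=
      EIL.card_starEdges _
    refine ⟨EIL.starNetwork ⟨0, by omega⟩ ∅, hnum, le_trans (ENNReal.ofReal_le_ofReal ?_)
      (EIL.starNetwork_expectedTime hk hkn hβ0 (by linarith) hA _)⟩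
    refine (EIL.bound_le hk hβ0 hβ1 (by positivity)).trans ?_
    have hn : (2 : ℝ) ≤ n := by exact_mod_cast (by omega : 2 ≤ n)
    rw [hnum, Nat.cast_sub (by omega)]
    push_cast
    nlinarith
  · set R := ⌈(k : ℝ) / β⌉₊
    set W := 16 * k * (1 + R) with hW
    have hkW : k ≤ W := by nlinarith
    have hW0 : (0 : ℝ) < W := by exact_mod_cast (by omega : 0 < W)
    refine ⟨1 / (12 * W), 72 * W + 24, by positivity, ?_⟩
    intro ε _ hε n m hn hnm hm A hA
    have hp := EIL.le_successRate hε
    have hm' : 12 * W * m ≤ n ^ 2 := by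
      rw [div_mul_eq_mul_div, one_mul, le_div_iff₀ (by positivity), mul_comm] at hm
      exact_mod_cast hm
    obtain ⟨a, b, f, hsize, hcore, hfill, hab⟩ :=
      -- With q = 16k the time is at least (16 · 0.59 - 1)kab > 8kab, while (m + n)/24 ≤ m/8 ≤ 8kab.
      EIL.exists_block_sizes (q := 16 * k) (R := R) (by omega) hn hnm hm'
    let φ : EIL.Site (16 * k) a b R f ≃ Fin n :=
      Fintype.equivFinOfCardEq (EIL.Site.card.trans hsize)
    obtain ⟨F, hF, hcard⟩ := EIL.exists_card_blockEdges φ hcore hfill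
    have hnum : (EIL.blockNetwork hF (EIL.certainEdges φ)).numEdges = m := hcard
    refine ⟨EIL.blockNetwork hF (EIL.certainEdges φ), hnum,
      le_trans (ENNReal.ofReal_le_ofReal ?_)
        (EIL.blockNetwork_expectedTime hk (by omega) (by omega) hβ0 (by linarith)
          (Nat.le_ceil _) hA hF hcard)⟩
    refine (EIL.bound_le hk hβ0 hβ1 (by positivity)).trans ?_
    have h₁ : (n : ℝ) ≤ m + 1 := by exact_mod_cast (by omega : n ≤ m + 1)
    have h₂ : (1 : ℝ) ≤ m := by exact_mod_cast (by omega : 1 ≤ m)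
    have h₃ : (m : ℝ) ≤ 64 * (k * (a * b)) := by
      have : (m : ℝ) ≤ 4 * (16 * k * a * b) := by exact_mod_cast hab
      linarith
    rw [hnum]
    push_cast
    have h₄ : 0 ≤ (k : ℝ) * (a * b) := by positivity
    nlinarith [mul_le_mul_of_nonneg_left hp h₄]
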